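/- Let $m,n,r\ge 1$ and let $\mathcal M_r=\{X\in\mathbb R^{m\times n} : \operatorname{rank} X=r\}$. Let $\|\cdot\|_F$ denote the Frobenius norm, $\|\cdot\|_2$ the spectral norm and $\sigma_r(X)$ the $r$-th largest singular value of $X$. For every $Y\in\mathcal M_r$ let a factorization $Y=U\Sigma V^\top$ be chosen, where $\Sigma\in\mathbb R^{r\times r}$ and $U\in\mathbb R^{m\times r}$, $V\in\mathbb R^{n\times r}$ have orthonormal columns. Let also selection matrices $S_U=[e_{p_1},\dots,e_{p_r}]\in\mathbb R^{m\times r}$ and $S_V=[e_{q_1},\dots,e_{q_r}]\in\mathbb R^{n\times r}$ be chosen (for instance by a DEIM procedure applied to $U$ and to $V$) such that $S_U^\top U$ and $S_V^\top V$ are invertible; no continuity of these choices in $Y$ is assumed. Let $C_{m,r},C_{n,r}$ be constants with $$\|(S_U^\top U)^{-1}\|_2\le C_{m,r},\qquad \|(S_V^\top V)^{-1}\|_2\le C_{n,r}\qquad\text{for all } Y\in\mathcal M_r .$$ Set $P_U=U(S_U^\top U)^{-1}S_U^\top$, $P_V=S_V(V^\top S_V)^{-1}V^\top$ and $$\mathcal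 P^{\angle}_Y[Z]=P_UZ-P_UZP_V+ZP_V .$$ Let $F:\mathbb R^{m\times n}\to\mathbb R^{m\times n}$ be a map, and let $B>0$ be such that $\|F(X)\|_F\le B$ for all $X$. Put $f(Y)=\mathcal P^{\angle}_Y[F(Y)]$ for $Y\in\mathcal M_r$, and define the Filippov set-valued map $$\mathcal F(Y)=\bigcap_{\epsilon>0}\overline{\operatorname{conv}}\,\bigl\{f(Z): Z\in\mathcal M_r,\ \|Z-Y\|_F\le\epsilon\bigr\},\qquad Y\in\mathcal M_r .$$ Then for every $Y_0\in\mathcal M_r$ there exist a real number $$t_{\max}>\frac{\sigma_r(Y_0)}{2\,C_{m,r}\,C_{n,r}\,B}$$ and a function $Y:[0,t_{\max})\to\mathcal M_r$ with $Y(0)=Y_0$ that is absolutely continuous on $[0,T]$ for every $T\in[0,t_{\max})$ and satisfies $\dot Y(t)\in\mathcal F(Y(t))$ for almost every $t\in[0,t_{\max})$. -/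

import Mathlib

open Set MeasureTheory
-- Matrices carry the Frobenius norm.
open scoped Matrix Matrix.Norms.Frobenius

noncomputable section

/-- The set `M_r` of real `m × n` matrices of rank exactly `r`. -/
def rankManifold (m n r : ℕ) : Set (Matrix (Fin m) (Fin n) ℝ) :=
  {X | X.rank = r}

/-- The spectral norm `‖A‖₂` of a square matrix. -/
def spectralNorm₂ {r : ℕ} (A : Matrix (Fin r) (Fin r) ℝ) : ℝ :=
  ‖Matrix.toEuclideanCLM (n := Fin r) (𝕜 := ℝ) A‖

/-- The `k`-th largest singular value, `k = 1, 2, …` (Mathlib counts them from `0`). -/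
def sigma {m n : ℕ} (k : ℕ) (X : Matrix (Fin m) (Fin n) ℝ) : ℝ :=
  (Matrix.toEuclideanLin X).singularValues (k - 1)

/-- The selection matrix `[e_{p 1}, …, e_{p r}]`. -/
def selectionMatrix {m r : ℕ} (p : Fin r → Fin m) : Matrix (Fin m) (Fin r) ℝ :=
  Matrix.of fun i k => if i = p k then 1 else 0

/-- The oblique projection `U (Sᵀ U)⁻¹ Sᵀ`, for a selection matrix `S`. -/
def obliqueLeft {m r : ℕ} (U S : Matrix (Fin m) (Fin r) ℝ) : Matrix (Fin m) (Fin m) ℝ :=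
  U * (Sᵀ * U)⁻¹ * Sᵀ

/-- The oblique projection `S (Vᵀ S)⁻¹ Vᵀ`, for a selection matrix `S`. -/
def obliqueRight {n r : ℕ} (V S : Matrix (Fin n) (Fin r) ℝ) : Matrix (Fin n) (Fin n) ℝ :=
  S * (Vᵀ * S)⁻¹ * Vᵀ

/-- The index selection used along `M_r`: for each `Y ∈ M_r`, a factorization `Y = U Σ Vᵀ` with
orthonormal `U`, `V`, together with `r` row indices and `r` column indices for which `S_Uᵀ U` and
`S_Vᵀ V` are invertible.  No regularity in `Y` is required; any deterministic DEIM procedure,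
applied to `U` and to `V`, gives an instance. Values outside `M_r` are irrelevant. -/
structure DEIMSelection (m n r : ℕ) where
  /-- orthonormal basis of the column space -/
  U : Matrix (Fin m) (Fin n) ℝ → Matrix (Fin m) (Fin r) ℝ
  /-- orthonormal basis of the row space -/
  V : Matrix (Fin m) (Fin n) ℝ → Matrix (Fin n) (Fin r) ℝ
  /-- selected rows -/
  rows : Matrix (Fin m) (Fin n) ℝ → Fin r → Fin m
  /-- selected columns -/
  cols : Matrix (Fin m) (Fin n) ℝ → Fin r → Fin n
  orthonormal_U : ∀ Y ∈ rankManifold m n r, (U Y)ᵀ * U Y = 1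
  orthonormal_V : ∀ Y ∈ rankManifold m n r, (V Y)ᵀ * V Y = 1
  factorization : ∀ Y ∈ rankManifold m n r,
    ∃ core : Matrix (Fin r) (Fin r) ℝ, Y = U Y * core * (V Y)ᵀ
  isUnit_rows : ∀ Y ∈ rankManifold m n r, IsUnit ((selectionMatrix (rows Y))ᵀ * U Y)
  isUnit_cols : ∀ Y ∈ rankManifold m n r, IsUnit ((selectionMatrix (cols Y))ᵀ * V Y)

namespace DEIMSelection

variable {m n r : ℕ} (D : DEIMSelection m n r)

/-- The selection matrix `S_U` at `Y`. -/
def SU (Y : Matrix (Fin m) (Fin n) ℝ) : Matrix (Fin m) (Fin r) ℝ :=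
  selectionMatrix (D.rows Y)

/-- The selection matrix `S_V` at `Y`. -/
def SV (Y : Matrix (Fin m) (Fin n) ℝ) : Matrix (Fin n) (Fin r) ℝ :=
  selectionMatrix (D.cols Y)

/-- The oblique projection onto the tangent space of `M_r` at `Y`,
`Z ↦ P_U Z - P_U Z P_V + Z P_V`. -/
def tangentProj (Y Z : Matrix (Fin m) (Fin n) ℝ) : Matrix (Fin m) (Fin n) ℝ :=
  obliqueLeft (D.U Y) (D.SU Y) * Z
    - obliqueLeft (D.U Y) (D.SU Y) * Z * obliqueRight (D.V Y) (D.SV Y)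
    + Z * obliqueRight (D.V Y) (D.SV Y)

/-- The (in general discontinuous) projected vector field `f(Y) = P_Y[F(Y)]`. -/
def field (F : Matrix (Fin m) (Fin n) ℝ → Matrix (Fin m) (Fin n) ℝ)
    (Y : Matrix (Fin m) (Fin n) ℝ) : Matrix (Fin m) (Fin n) ℝ :=
  D.tangentProj Y (F Y)

/-- The Filippov set-valued map
`𝓕(Y) = ⋂_{ε > 0} closure (conv (f ((Y + ε 𝓑) ∩ M_r)))`, `𝓑` the closed Frobenius unit ball. -/
def filippov (F : Matrix (Fin m) (Fin n) ℝ → Matrix (Fin m) (Fin n) ℝ)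
    (Y : Matrix (Fin m) (Fin n) ℝ) : Set (Matrix (Fin m) (Fin n) ℝ) :=
  ⋂ (ε : ℝ) (_ : 0 < ε),
    closure (convexHull ℝ (D.field F '' (Metric.closedBall Y ε ∩ rankManifold m n r)))

/-- `Y` solves the DLRA-DEIM differential inclusion on `[0, T]` with initial value `Y₀`: it is
absolutely continuous on `[0, T]` with values in `M_r`, `Y(0) = Y₀`, and for almost every
`t ∈ [0, T]` it is differentiable at `t` with derivative in `𝓕(Y(t))`. -/
def IsSolutionOn (F : Matrix (Fin m) (Fin n) ℝ → Matrix (Fin m) (Fin n) ℝ)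
    (Y₀ : Matrix (Fin m) (Fin n) ℝ) (Y : ℝ → Matrix (Fin m) (Fin n) ℝ) (T : ℝ) : Prop :=
  AbsolutelyContinuousOnInterval Y 0 T ∧
  (∀ t ∈ Icc 0 T, Y t ∈ rankManifold m n r) ∧
  Y 0 = Y₀ ∧
  ∀ᵐ t ∂(volume.restrict (Icc 0 T)), ∃ Z ∈ D.filippov F (Y t), HasDerivAt Y Z t

end DEIMSelection

end

/-! Since `f` may be discontinuous, a solution is built as a limit of Euler polygons: a difference
quotient of the limit is a limit of convex combinations of values of `f` at nearby points, which is
exactly what the Filippov map allows (`exists_lipschitz_filippov_solution`). Three facts make this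
work.

Compactness: in the ball of radius `ρ < σ_r(Y₀)` no matrix has rank below `r`, so there rank `r`
means rank at most `r`, a closed condition.

Staying on the manifold: an Euler step from `Y = U C Vᵀ` is corrected to rank at most `r` with an
`O(h²)` error. The constant involves `‖C⁻¹‖₂ ≤ 1 / (σ_r(Y₀) - ρ)`, uniform on the ball
(`exists_rank_le_norm_sub_euler_le`).

Speed: `‖f‖ ≤ Cm * Cn * B` (`norm_tangentProj_le`), because an idempotent inherits the norm bound of
its complement, and the complement here is `Z ↦ (1 - P_U) Z (1 - P_V)`. Hence the ball is not left
before time `ρ / (Cm * Cn * B)`. -/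

/-! ### Limits of Euler sequences for discontinuous fields. -/

section EulerLimit

open Filter Topology

theorem norm_sub_le_of_norm_succ_sub_le
    {E : Type*} [SeminormedAddCommGroup E] {y : ℕ → E} {d : ℝ}
    (hy : ∀ k, ‖y (k + 1) - y k‖ ≤ d)
    (j k : ℕ) : ‖y j - y k‖ ≤ |(j : ℝ) - k| * d := by
  have key : ∀ a b : ℕ, ‖y (a + b) - y a‖ ≤ b * d := by
    intro a b
    induction b with
    | zero => simp
    | succ b ih =>
      calc ‖y (a + (b + 1)) - y a‖ = ‖(y (a + b + 1) - y (a + b)) + (y (a + b) - y a)‖ := by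
            rw [add_assoc]; congr 1; abel
        _ ≤ d + b * d := (norm_add_le _ _).trans (add_le_add (hy _) ih)
        _ = _ := by push_cast; ring
  rcases le_total k j with h | h
  · obtain ⟨b, rfl⟩ := Nat.exists_eq_add_of_le h
    simpa using key k b
  · obtain ⟨b, rfl⟩ := Nat.exists_eq_add_of_le h
    rw [norm_sub_rev]
    simpa using key j b

variable {E : Type*} [NormedAddCommGroup E] [NormedSpace ℝ E]

/-- A discrete trajectory which stays in `S`, whose increments have norm at most `h * (L + K * h)`,
and which makes Euler steps up to an error `K * h ^ 2` as long as it cannot leave the ball. -/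
theorem exists_euler_sequence {S : Set E} {f : E → E} {y₀ : E} {ρ L K : ℝ} (hL : 0 ≤ L)
    (hK : 0 ≤ K) (hy₀ : y₀ ∈ S) (hf : ∀ y ∈ S, ‖f y‖ ≤ L)
    (hstep : ∀ y ∈ S, ∀ h : ℝ, 0 < h → ∃ y' : E, ‖y' - (y + h • f y)‖ ≤ K * h ^ 2 ∧
      (y' ∈ Metric.closedBall y₀ ρ → y' ∈ S)) {h : ℝ} (hh : 0 < h) :
    ∃ y : ℕ → E, y 0 = y₀ ∧ (∀ k, y k ∈ S) ∧ (∀ k, ‖y (k + 1) - y k‖ ≤ h * (L + K * h)) ∧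
      ∀ k : ℕ, (k + 1) * (h * (L + K * h)) ≤ ρ →
        ‖y (k + 1) - (y k + h • f (y k))‖ ≤ K * h ^ 2 := by
  have hd : 0 ≤ h * (L + K * h) := by positivity
  have key : ∀ y : S, ∃ y' : S, ‖(y' : E) - y‖ ≤ h * (L + K * h) ∧
      (‖(y : E) - y₀‖ + h * (L + K * h) ≤ ρ → ‖(y' : E) - (y + h • f y)‖ ≤ K * h ^ 2) := by
    rintro ⟨y, hy⟩
    obtain ⟨y', h1, h2⟩ := hstep y hy h hh
    have h3 : ‖y' - y‖ ≤ h * (L + K * h) := by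
      calc ‖y' - y‖ = ‖(y' - (y + h • f y)) + h • f y‖ := by congr 1; abel
        _ ≤ K * h ^ 2 + h * L := by
          refine (norm_add_le _ _).trans (add_le_add h1 ?_)
          rw [norm_smul, Real.norm_of_nonneg hh.le]
          gcongr
          exact hf y hy
        _ = _ := by ring
    -- If a step might leave the ball, the sequence stays put. This keeps it in `S` forever and
    -- costs nothing before the exit time.
    by_cases hc : ‖y - y₀‖ + h * (L + K * h) ≤ ρ
    · refine ⟨⟨y', h2 ?_⟩, h3, fun _ ↦ h1⟩
      rw [mem_closedBall_iff_norm]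
      calc ‖y' - y₀‖ = ‖(y' - y) + (y - y₀)‖ := by congr 1; abel
        _ ≤ ρ := by linarith [norm_add_le (y' - y) (y - y₀)]
    · exact ⟨⟨y, hy⟩, by simpa using hd, fun h ↦ absurd h hc⟩
  choose g hg1 hg2 using key
  let z : ℕ → S := fun k ↦ g^[k] ⟨y₀, hy₀⟩
  have hz : ∀ k, z (k + 1) = g (z k) := fun k ↦ Function.iterate_succ_apply' _ _ _
  have hinc : ∀ k, ‖(z (k + 1) : E) - z k‖ ≤ h * (L + K * h) := fun k ↦ by
    rw [hz]; exact hg1 _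
  have hdist : ∀ k : ℕ, ‖(z k : E) - y₀‖ ≤ k * (h * (L + K * h)) := by
    intro k
    induction k with
    | zero => simp [z]
    | succ k ih =>
      calc ‖(z (k + 1) : E) - y₀‖ = ‖((z (k + 1) : E) - z k) + (z k - y₀)‖ := by congr 1; abel
        _ ≤ h * (L + K * h) + k * (h * (L + K * h)) :=
          (norm_add_le _ _).trans (add_le_add (hinc k) ih)
        _ = _ := by push_cast; ring
  refine ⟨fun k ↦ z k, rfl, fun k ↦ (z k).2, hinc, fun k hk ↦ ?_⟩
  simp only [hz]
  exact hg2 _ (by linarith [hdist k])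

theorem abs_natFloor_sub_natFloor_le (a b : ℝ) : |(⌊a⌋₊ : ℝ) - ⌊b⌋₊| ≤ |a - b| + 1 := by
  wlog h : b ≤ a generalizing a b
  · rw [abs_sub_comm, abs_sub_comm a]
    exact this b a (le_of_not_ge h)
  have h1 : (⌊b⌋₊ : ℝ) ≤ ⌊a⌋₊ := by exact_mod_cast Nat.floor_mono h
  rw [abs_of_nonneg (by linarith), abs_of_nonneg (by linarith)]
  have h2 := Nat.lt_floor_add_one b
  rcases le_total 0 a with ha | ha
  · linarith [Nat.floor_le ha]
  · rw [Nat.floor_of_nonpos ha]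
    have : (0 : ℝ) ≤ ⌊b⌋₊ := Nat.cast_nonneg _
    push_cast
    linarith

/-- Limits of Euler sequences on a compact piece of a set `S` with values of `f` approximately
tangent to `S` are Lipschitz, and their derivatives lie in the Filippov regularization of `f`. -/
theorem exists_lipschitz_filippov_solution [FiniteDimensional ℝ E] {S : Set E} {f : E → E} {y₀ : E}
    {ρ L K : ℝ} (hL : 0 ≤ L) (hK : 0 ≤ K) (hS : IsClosed S) (hSρ : S ⊆ Metric.closedBall y₀ ρ)
    (hy₀ : y₀ ∈ S) (hf : ∀ y ∈ S, ‖f y‖ ≤ L)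
    (hstep : ∀ y ∈ S, ∀ h : ℝ, 0 < h → ∃ y' : E, ‖y' - (y + h • f y)‖ ≤ K * h ^ 2 ∧
      (y' ∈ Metric.closedBall y₀ ρ → y' ∈ S)) :
    ∃ Y : ℝ → E, LipschitzWith L.toNNReal Y ∧ Y 0 = y₀ ∧ (∀ t, Y t ∈ S) ∧
      ∀ t, 0 ≤ t → L * t < ρ → ∀ Z, HasDerivAt Y Z t → ∀ ε, 0 < ε →
        Z ∈ closure (convexHull ℝ (f '' (Metric.closedBall (Y t) ε ∩ S))) := by
  have : ProperSpace E := FiniteDimensional.proper ℝ E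
  have hcomp : IsCompact S := Metric.isCompact_of_isClosed_isBounded hS
    (Metric.isBounded_closedBall.subset hSρ)
  let h : ℕ → ℝ := fun N ↦ 1 / ((N : ℝ) + 1)
  have hpos : ∀ N, 0 < h N := fun N ↦ by positivity
  have hmul : ∀ N : ℕ, ((N : ℝ) + 1) * h N = 1 := fun N ↦ by
    have : (N : ℝ) + 1 ≠ 0 := by positivity
    simp only [h]; field_simp
  have hseq := fun N ↦ exists_euler_sequence hL hK hy₀ hf hstep (hpos N)
  choose y hy0 hyS hyd hye using hseq
  -- A free ultrafilter gives limits for all `t` at once, so no subsequence has to be extracted.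
  let 𝒰 : Ultrafilter ℕ := hyperfilter ℕ
  have h𝒰 : (𝒰 : Filter ℕ) ≤ atTop := by
    rw [← Nat.cofinite_eq_atTop]; exact hyperfilter_le_cofinite
  have htend : Tendsto h 𝒰 (𝓝 0) := tendsto_one_div_add_atTop_nhds_zero_nat.mono_left h𝒰
  -- For `t < 0` the natural floor is `0`, so `Y` is defined on all of `ℝ` and equals `y₀` there.
  have hex : ∀ t : ℝ, ∃ z ∈ S, Tendsto (fun N ↦ y N ⌊t * ((N : ℝ) + 1)⌋₊) 𝒰 (𝓝 z) := by
    intro t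
    refine hcomp.ultrafilter_le_nhds (𝒰.map fun N ↦ y N ⌊t * ((N : ℝ) + 1)⌋₊) ?_
    rw [le_principal_iff]
    exact Ultrafilter.mem_map.2 (Filter.univ_mem' fun N ↦ hyS N _)
  choose Y hYS hY using hex
  have hfloor : ∀ (s t : ℝ) (N : ℕ),
      |(⌊s * ((N : ℝ) + 1)⌋₊ : ℝ) - ⌊t * ((N : ℝ) + 1)⌋₊| * h N ≤ |s - t| + h N := by
    intro s t N
    calc _ ≤ (|s * ((N : ℝ) + 1) - t * ((N : ℝ) + 1)| + 1) * h N := by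
          exact mul_le_mul_of_nonneg_right (abs_natFloor_sub_natFloor_le _ _) (hpos N).le
      _ = |s - t| * (((N : ℝ) + 1) * h N) + h N := by
          rw [← sub_mul, abs_mul, abs_of_nonneg (by positivity : (0 : ℝ) ≤ (N : ℝ) + 1)]; ring
      _ = _ := by rw [hmul, mul_one]
  have hLK : ∀ N, 0 ≤ L + K * h N := fun N ↦ by have := hpos N; positivity
  have htLK : Tendsto (fun N ↦ L + K * h N) 𝒰 (𝓝 L) := by
    simpa using (htend.const_mul K).const_add L
  have hLip : LipschitzWith L.toNNReal Y := by
    refine LipschitzWith.of_dist_le_mul fun s t ↦ ?_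
    rw [Real.coe_toNNReal _ hL, dist_eq_norm, Real.dist_eq]
    have h1 : Tendsto (fun N ↦ (|s - t| + h N) * (L + K * h N)) 𝒰 (𝓝 (|s - t| * L)) := by
      simpa using (htend.const_add |s - t|).mul htLK
    rw [mul_comm]
    refine le_of_tendsto_of_tendsto ((hY s).sub (hY t)).norm h1 (Eventually.of_forall fun N ↦ ?_)
    calc _ ≤ _ := norm_sub_le_of_norm_succ_sub_le (hyd N) _ _
      _ = (|(⌊s * ((N : ℝ) + 1)⌋₊ : ℝ) - ⌊t * ((N : ℝ) + 1)⌋₊| * h N) * (L + K * h N) := by ring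
      _ ≤ _ := mul_le_mul_of_nonneg_right (hfloor s t N) (hLK N)
  refine ⟨Y, hLip, ?_, hYS, ?_⟩
  · have := hY 0
    simp only [zero_mul, Nat.floor_zero, hy0] at this
    exact tendsto_nhds_unique this tendsto_const_nhds
  intro t ht hLt Z hZ ε hε
  -- The target set is closed and does not depend on `η`, so it suffices to place the right
  -- difference quotients in it.
  have hquot : ∀ᶠ η : ℝ in 𝓝[>] 0, η⁻¹ • (Y (t + η) - Y t) ∈
      closure (convexHull ℝ (f '' (Metric.closedBall (Y t) ε ∩ S))) := by
    have e1 : ∀ᶠ η : ℝ in 𝓝[>] 0, L * (t + η) < ρ := by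
      have h1 : Continuous fun η : ℝ ↦ L * (t + η) := by fun_prop
      exact ((h1.tendsto 0).eventually_lt_const (by simpa using hLt)).filter_mono
        nhdsWithin_le_nhds
    have e2 : ∀ᶠ η : ℝ in 𝓝[>] 0, η * L < ε := by
      have h1 : Continuous fun η : ℝ ↦ η * L := by fun_prop
      exact ((h1.tendsto 0).eventually_lt_const (by simpa using hε)).filter_mono
        nhdsWithin_le_nhds
    filter_upwards [e1, e2, self_mem_nhdsWithin] with η hη1 hη2 hη0
    have hη0 : 0 < η := hη0
    let a : ℕ → ℕ := fun N ↦ ⌊t * ((N : ℝ) + 1)⌋₊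
    let b : ℕ → ℕ := fun N ↦ ⌊(t + η) * ((N : ℝ) + 1)⌋₊
    have hab : ∀ N, a N ≤ b N := fun N ↦ Nat.floor_mono (by gcongr; linarith)
    -- The discrete time between the two grid points, which tends to `η`; dividing by it rather than
    -- by `η` makes the weights below sum to exactly `1`.
    let c : ℕ → ℝ := fun N ↦ ((b N : ℝ) - a N) * h N
    have hc_le : ∀ N, c N ≤ η + h N := fun N ↦ by
      have := hfloor (t + η) t N
      rw [add_sub_cancel_left, abs_of_pos hη0] at this
      exact (mul_le_mul_of_nonneg_right (le_abs_self _) (hpos N).le).trans this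
    have hc_ge : ∀ N, η - h N ≤ c N := fun N ↦ by
      have h1 := Nat.lt_floor_add_one ((t + η) * ((N : ℝ) + 1))
      have h2 := Nat.floor_le (show 0 ≤ t * ((N : ℝ) + 1) by positivity)
      have h3 : (t + η) * ((N : ℝ) + 1) - 1 - t * ((N : ℝ) + 1) ≤ (b N : ℝ) - a N := by
        simp only [a, b]; linarith
      calc η - h N = η * (((N : ℝ) + 1) * h N) - h N := by rw [hmul, mul_one]
        _ = ((t + η) * ((N : ℝ) + 1) - 1 - t * ((N : ℝ) + 1)) * h N := by ring
        _ ≤ c N := mul_le_mul_of_nonneg_right h3 (hpos N).le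
    have htc : Tendsto c 𝒰 (𝓝 η) := by
      refine tendsto_of_tendsto_of_tendsto_of_le_of_le (g := fun N ↦ η - h N)
        (h := fun N ↦ η + h N) ?_ ?_ hc_ge hc_le
      · simpa using htend.const_sub η
      · simpa using htend.const_add η
    let s : ℕ → E := fun N ↦ ∑ k ∈ Finset.Ico (a N) (b N), h N • f (y N k)
    have hbh : ∀ N, (b N : ℝ) * h N ≤ t + η := fun N ↦ by
      calc (b N : ℝ) * h N ≤ ((t + η) * ((N : ℝ) + 1)) * h N :=
            mul_le_mul_of_nonneg_right (Nat.floor_le (by positivity)) (hpos N).le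
        _ = _ := by rw [mul_assoc, hmul, mul_one]
    have hs : Tendsto s 𝒰 (𝓝 (Y (t + η) - Y t)) := by
      have h1 : Tendsto (fun N ↦ (y N (b N) - y N (a N)) - s N) 𝒰 (𝓝 0) := by
        have h2 : Tendsto (fun N ↦ (η + h N) * (K * h N)) 𝒰 (𝓝 0) := by
          simpa using (htend.const_add η).mul (htend.const_mul K)
        refine squeeze_zero_norm' ?_ h2
        -- The strict inequality `L * (t + η) < ρ` leaves room for `K * h N`, so every step up to `b
        -- N` is a genuine Euler step.
        have h3 : ∀ᶠ N in (𝒰 : Filter ℕ), (t + η) * (L + K * h N) < ρ := by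
          refine (htLK.const_mul (t + η)).eventually_lt_const ?_
          linarith [mul_comm L (t + η)]
        filter_upwards [h3] with N hN
        have h4 : y N (b N) - y N (a N) - s N =
            ∑ k ∈ Finset.Ico (a N) (b N), (y N (k + 1) - (y N k + h N • f (y N k))) := by
          rw [← Finset.sum_Ico_sub (y N) (hab N), ← Finset.sum_sub_distrib]
          exact Finset.sum_congr rfl fun k _ ↦ by abel
        rw [h4]
        calc _ ≤ ∑ k ∈ Finset.Ico (a N) (b N), K * h N ^ 2 := by
              refine norm_sum_le_of_le _ fun k hk ↦ hye N k ?_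
              have hk1 : (k : ℝ) + 1 ≤ b N := by exact_mod_cast (Finset.mem_Ico.1 hk).2
              calc ((k : ℝ) + 1) * (h N * (L + K * h N))
                    = (((k : ℝ) + 1) * h N) * (L + K * h N) := by ring
                _ ≤ (t + η) * (L + K * h N) := by
                  refine mul_le_mul_of_nonneg_right ?_ (hLK N)
                  exact (mul_le_mul_of_nonneg_right hk1 (hpos N).le).trans (hbh N)
                _ ≤ ρ := hN.le
          _ = c N * (K * h N) := by
              rw [Finset.sum_const, Nat.card_Ico, nsmul_eq_mul, Nat.cast_sub (hab N)]
              simp only [c]; ring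
          _ ≤ _ := mul_le_mul_of_nonneg_right (hc_le N) (mul_nonneg hK (hpos N).le)
      simpa [a, b] using ((hY (t + η)).sub (hY t)).sub h1
    refine isClosed_closure.mem_of_tendsto ((htc.inv₀ hη0.ne').smul hs) ?_
    have e3 : ∀ᶠ N in (𝒰 : Filter ℕ), 0 < c N := htc.eventually_const_lt hη0
    have e4 : ∀ᶠ N in (𝒰 : Filter ℕ),
        (η + h N) * (L + K * h N) + ‖y N (a N) - Y t‖ < ε := by
      have h1 : Tendsto (fun N ↦ (η + h N) * (L + K * h N) + ‖y N (a N) - Y t‖) 𝒰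
          (𝓝 (η * L)) := by
        simpa using ((htend.const_add η).mul htLK).add ((hY t).sub_const (Y t)).norm
      exact h1.eventually_lt_const hη2
    filter_upwards [e3, e4] with N hN3 hN4
    refine subset_closure ?_
    have h1 : (c N)⁻¹ • s N =
        ∑ k ∈ Finset.Ico (a N) (b N), ((c N)⁻¹ * h N) • f (y N k) := by
      rw [Finset.smul_sum]
      exact Finset.sum_congr rfl fun k _ ↦ by rw [smul_smul]
    rw [h1]
    refine (convex_convexHull ℝ _).sum_mem (fun k _ ↦ ?_) ?_ (fun k hk ↦ ?_)
    · have := hpos N; positivity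
    · rw [Finset.sum_const, Nat.card_Ico, nsmul_eq_mul, Nat.cast_sub (hab N)]
      calc ((b N : ℝ) - a N) * ((c N)⁻¹ * h N) = (c N)⁻¹ * c N := by simp only [c]; ring
        _ = 1 := inv_mul_cancel₀ hN3.ne'
    · refine subset_convexHull _ _ ⟨y N k, ⟨?_, hyS N k⟩, rfl⟩
      rw [mem_closedBall_iff_norm]
      obtain ⟨hk1, hk2⟩ := Finset.mem_Ico.1 hk
      have hk1' : (a N : ℝ) ≤ k := by exact_mod_cast hk1
      have hk2' : (k : ℝ) ≤ b N := by exact_mod_cast hk2.le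
      -- All points visited between the two times lie within about `η * L < ε` of `Y t`.
      have h2 : ‖y N k - y N (a N)‖ ≤ (η + h N) * (L + K * h N) := by
        calc _ ≤ |(k : ℝ) - a N| * (h N * (L + K * h N)) :=
              norm_sub_le_of_norm_succ_sub_le (hyd N) _ _
          _ = (((k : ℝ) - a N) * h N) * (L + K * h N) := by
              rw [abs_of_nonneg (by linarith)]; ring
          _ ≤ c N * (L + K * h N) := by
              refine mul_le_mul_of_nonneg_right ?_ (hLK N)
              exact mul_le_mul_of_nonneg_right (by linarith) (hpos N).le
          _ ≤ _ := mul_le_mul_of_nonneg_right (hc_le N) (hLK N)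
      calc ‖y N k - Y t‖ = ‖(y N k - y N (a N)) + (y N (a N) - Y t)‖ := by congr 1; abel
        _ ≤ ε := (norm_add_le _ _).trans (by linarith)
  exact isClosed_closure.mem_of_tendsto hZ.tendsto_slope_zero_right hquot

end EulerLimit

/-! ### Idempotents and the Frobenius norm. -/

/-- In an inner product space, the complement of an idempotent obeys the norm bound of the
idempotent. -/
theorem norm_sub_apply_le_of_idempotent {E : Type*} [NormedAddCommGroup E] [InnerProductSpace ℝ E]
    (P : E →ₗ[ℝ] E) (hP : ∀ x, P (P x) = P x) {c : ℝ} (hc : 1 ≤ c) (h : ∀ x, ‖P x‖ ≤ c * ‖x‖)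
    (x : E) : ‖x - P x‖ ≤ c * ‖x‖ := by
  have hv : P (x - P x) = 0 := by rw [map_sub, hP, sub_self]
  set u := P x with hu
  set v := x - u with hvdef
  have hx : x = u + v := by rw [hvdef]; abel
  have hPu : P u = u := hP x
  by_cases hu0 : u = 0
  · rw [hx, hu0, zero_add]
    nlinarith [norm_nonneg v]
  by_cases hv0 : v = 0
  · rw [hv0, norm_zero]
    positivity
  have hun : ‖u‖ ≠ 0 := norm_ne_zero_iff.2 hu0
  have hvn : ‖v‖ ≠ 0 := norm_ne_zero_iff.2 hv0
  -- Exchanging the lengths of `u = P x` and `v = x - P x` preserves the norm of their sum, while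
  -- `P` sends the new vector to one of norm `‖v‖`.
  have key := h ((‖v‖ / ‖u‖) • u + (‖u‖ / ‖v‖) • v)
  rw [map_add, map_smul, map_smul, hPu, hv, smul_zero, add_zero, norm_smul, Real.norm_of_nonneg
    (by positivity), div_mul_cancel₀ _ hun] at key
  have heq : ‖(‖v‖ / ‖u‖) • u + (‖u‖ / ‖v‖) • v‖ = ‖x‖ := by
    rw [hx, ← sq_eq_sq₀ (norm_nonneg _) (norm_nonneg _), norm_add_sq_real, norm_add_sq_real,
      norm_smul, norm_smul, inner_smul_left, inner_smul_right, Real.norm_of_nonneg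
      (by positivity), Real.norm_of_nonneg (by positivity)]
    simp only [conj_trivial]
    field_simp
    ring
  rwa [heq] at key

namespace Matrix

variable {l m n k : Type*} [Fintype l] [Fintype m] [Fintype n] [Fintype k]

theorem frobenius_norm_sq (A : Matrix m n ℝ) : ‖A‖ ^ 2 = ∑ i, ∑ j, A i j ^ 2 := by
  rw [frobenius_norm_def, ← Real.sqrt_eq_rpow, Real.sq_sqrt (by positivity)]
  simp

theorem frobenius_norm_sq_eq_trace (A : Matrix m n ℝ) : ‖A‖ ^ 2 = (Aᵀ * A).trace := by
  rw [frobenius_norm_sq, Finset.sum_comm]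
  simp [trace, mul_apply, sq]

/-- The inner product `⟪A, B⟫ = tr (Aᵀ B)`, whose norm is the Frobenius norm. -/
noncomputable abbrev frobeniusInnerProductSpace : InnerProductSpace ℝ (Matrix m n ℝ) where
  inner A B := (Aᵀ * B).trace
  norm_sq_eq_re_inner A := frobenius_norm_sq_eq_trace A
  conj_inner_symm A B := by
    rw [conj_trivial, ← trace_transpose, transpose_mul, transpose_transpose]
  add_left A B C := by rw [transpose_add, Matrix.add_mul, trace_add]
  smul_left A B c := by
    rw [transpose_smul, Matrix.smul_mul, trace_smul, conj_trivial, smul_eq_mul]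

theorem frobenius_norm_sub_apply_le (P : Matrix m n ℝ →ₗ[ℝ] Matrix m n ℝ)
    (hP : ∀ Z, P (P Z) = P Z) {c : ℝ} (hc : 1 ≤ c) (h : ∀ Z, ‖P Z‖ ≤ c * ‖Z‖)
    (Z : Matrix m n ℝ) : ‖Z - P Z‖ ≤ c * ‖Z‖ := by
  let : InnerProductSpace ℝ (Matrix m n ℝ) := frobeniusInnerProductSpace
  exact norm_sub_apply_le_of_idempotent P hP hc h Z

theorem frobenius_norm_sq_eq_sum_col (A : Matrix m n ℝ) :
    ‖A‖ ^ 2 = ∑ j, ‖WithLp.toLp 2 (A.col j)‖ ^ 2 := by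
  rw [frobenius_norm_sq, Finset.sum_comm]
  simp [EuclideanSpace.norm_sq_eq]

theorem frobenius_norm_mul_le_of_mulVec_le {A : Matrix l m ℝ} {c : ℝ} (hc : 0 ≤ c)
    (h : ∀ x : EuclideanSpace ℝ m, ‖WithLp.toLp 2 (A *ᵥ x.ofLp)‖ ≤ c * ‖x‖) (Z : Matrix m n ℝ) :
    ‖A * Z‖ ≤ c * ‖Z‖ := by
  rw [← sq_le_sq₀ (norm_nonneg _) (by positivity), mul_pow, frobenius_norm_sq_eq_sum_col,
    frobenius_norm_sq_eq_sum_col, Finset.mul_sum]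
  refine Finset.sum_le_sum fun j _ ↦ ?_
  rw [← mul_pow]
  exact pow_le_pow_left₀ (norm_nonneg _) (h (WithLp.toLp 2 (Z.col j))) 2

variable [DecidableEq k]

theorem frobenius_norm_mul_of_orthonormal {U : Matrix m k ℝ} (hU : Uᵀ * U = 1)
    (Z : Matrix k n ℝ) : ‖U * Z‖ = ‖Z‖ := by
  rw [← sq_eq_sq₀ (norm_nonneg _) (norm_nonneg _), frobenius_norm_sq_eq_trace,
    frobenius_norm_sq_eq_trace, transpose_mul, Matrix.mul_assoc, ← Matrix.mul_assoc Uᵀ, hU,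
    Matrix.one_mul]

/-- Bessel's inequality: the defect of squares is `‖Z - U Uᵀ Z‖ ^ 2`. -/
theorem frobenius_norm_transpose_mul_le_of_orthonormal {U : Matrix m k ℝ} (hU : Uᵀ * U = 1)
    (Z : Matrix m n ℝ) : ‖Uᵀ * Z‖ ≤ ‖Z‖ := by
  rw [← sq_le_sq₀ (norm_nonneg _) (norm_nonneg _)]
  have h1 := sq_nonneg ‖Z - U * (Uᵀ * Z)‖
  have h2 : (Z - U * (Uᵀ * Z))ᵀ * (Z - U * (Uᵀ * Z)) = Zᵀ * Z - (Uᵀ * Z)ᵀ * (Uᵀ * Z) := by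
    simp only [transpose_sub, transpose_mul, transpose_transpose, Matrix.sub_mul, Matrix.mul_sub,
      Matrix.mul_assoc]
    rw [← Matrix.mul_assoc Uᵀ U, hU, Matrix.one_mul]
    abel
  rw [frobenius_norm_sq_eq_trace, h2, trace_sub, ← frobenius_norm_sq_eq_trace,
    ← frobenius_norm_sq_eq_trace] at h1
  linarith

end Matrix

/-! ### Norm bounds for the oblique projections. -/

section ObliqueProjection

variable {m n r : ℕ}

theorem selectionMatrix_transpose_mul_self {p : Fin r → Fin m} (hp : Function.Injective p) :
    (selectionMatrix p)ᵀ * selectionMatrix p = 1 := by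
  ext i j
  simp [selectionMatrix, Matrix.mul_apply, Matrix.one_apply, hp.eq_iff, eq_comm]

/-- A repeated index would give two equal rows. Injectivity makes the columns of the selection
matrix orthonormal. -/
theorem injective_of_isUnit_selectionMatrix {p : Fin r → Fin m} {U : Matrix (Fin m) (Fin r) ℝ}
    (h : IsUnit ((selectionMatrix p)ᵀ * U)) : Function.Injective p := by
  intro i j hij
  by_contra hne
  rw [Matrix.isUnit_iff_isUnit_det] at h
  refine h.ne_zero (Matrix.det_zero_of_row_eq hne ?_)
  ext a
  simp [selectionMatrix, Matrix.mul_apply, hij]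

theorem frobenius_norm_mul_le_spectralNorm₂ (A : Matrix (Fin r) (Fin r) ℝ)
    (Z : Matrix (Fin r) (Fin n) ℝ) : ‖A * Z‖ ≤ spectralNorm₂ A * ‖Z‖ := by
  refine Matrix.frobenius_norm_mul_le_of_mulVec_le (norm_nonneg _) (fun x ↦ ?_) Z
  exact (Matrix.toEuclideanCLM (n := Fin r) (𝕜 := ℝ) A).le_opNorm x

variable {U : Matrix (Fin m) (Fin r) ℝ} {p : Fin r → Fin m}

theorem obliqueLeft_mul_basis (h : IsUnit ((selectionMatrix p)ᵀ * U)) :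
    obliqueLeft U (selectionMatrix p) * U = U := by
  rw [Matrix.isUnit_iff_isUnit_det] at h
  rw [obliqueLeft, Matrix.mul_assoc, Matrix.mul_assoc, Matrix.nonsing_inv_mul _ h, Matrix.mul_one]

theorem obliqueLeft_mul_self (h : IsUnit ((selectionMatrix p)ᵀ * U)) :
    obliqueLeft U (selectionMatrix p) * obliqueLeft U (selectionMatrix p) =
      obliqueLeft U (selectionMatrix p) := by
  nth_rw 2 3 [obliqueLeft]
  rw [Matrix.mul_assoc U, ← Matrix.mul_assoc, obliqueLeft_mul_basis h]

theorem obliqueRight_eq_transpose (U S : Matrix (Fin m) (Fin r) ℝ) :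
    obliqueRight U S = (obliqueLeft U S)ᵀ := by
  simp only [obliqueRight, obliqueLeft, Matrix.transpose_mul, Matrix.transpose_nonsing_inv,
    Matrix.transpose_transpose, Matrix.mul_assoc]

variable {c : ℝ}

theorem norm_core_mul_le (h : IsUnit ((selectionMatrix p)ᵀ * U))
    (hc : spectralNorm₂ ((selectionMatrix p)ᵀ * U)⁻¹ ≤ c) (Z : Matrix (Fin m) (Fin n) ℝ) :
    ‖((selectionMatrix p)ᵀ * U)⁻¹ * (selectionMatrix p)ᵀ * Z‖ ≤ c * ‖Z‖ := by
  rw [Matrix.mul_assoc]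
  refine (frobenius_norm_mul_le_spectralNorm₂ _ _).trans ?_
  refine mul_le_mul hc ?_ (norm_nonneg _) ((norm_nonneg _).trans hc)
  exact Matrix.frobenius_norm_transpose_mul_le_of_orthonormal (selectionMatrix_transpose_mul_self
    (injective_of_isUnit_selectionMatrix h)) Z

theorem norm_obliqueLeft_mul_le (hU : Uᵀ * U = 1) (h : IsUnit ((selectionMatrix p)ᵀ * U))
    (hc : spectralNorm₂ ((selectionMatrix p)ᵀ * U)⁻¹ ≤ c) (Z : Matrix (Fin m) (Fin n) ℝ) :
    ‖obliqueLeft U (selectionMatrix p) * Z‖ ≤ c * ‖Z‖ := by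
  rw [obliqueLeft, Matrix.mul_assoc U, Matrix.mul_assoc U, Matrix.frobenius_norm_mul_of_orthonormal
    hU]
  exact norm_core_mul_le h hc Z

/-- The projection fixes `U`, which is nonzero because `0 < r`. -/
theorem one_le_of_spectralNorm₂_le (hr : 0 < r) (hU : Uᵀ * U = 1)
    (h : IsUnit ((selectionMatrix p)ᵀ * U))
    (hc : spectralNorm₂ ((selectionMatrix p)ᵀ * U)⁻¹ ≤ c) : 1 ≤ c := by
  have h1 := norm_obliqueLeft_mul_le hU h hc U
  rw [obliqueLeft_mul_basis h] at h1
  have h2 : 0 < ‖U‖ := by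
    rw [norm_pos_iff]
    rintro rfl
    have : (0 : ℝ) = 1 := by simpa using congrFun (congrFun hU ⟨0, hr⟩) ⟨0, hr⟩
    norm_num at this
  nlinarith

theorem norm_sub_obliqueLeft_mul_le (hr : 0 < r) (hU : Uᵀ * U = 1)
    (h : IsUnit ((selectionMatrix p)ᵀ * U))
    (hc : spectralNorm₂ ((selectionMatrix p)ᵀ * U)⁻¹ ≤ c) (Z : Matrix (Fin m) (Fin n) ℝ) :
    ‖Z - obliqueLeft U (selectionMatrix p) * Z‖ ≤ c * ‖Z‖ := by
  refine Matrix.frobenius_norm_sub_apply_le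
    (mulLeftLinearMap (Fin n) ℝ (obliqueLeft U (selectionMatrix p))) (fun Z ↦ ?_)
    (one_le_of_spectralNorm₂_le hr hU h hc) (norm_obliqueLeft_mul_le hU h hc) Z
  simp only [mulLeftLinearMap_apply]
  rw [← Matrix.mul_assoc, obliqueLeft_mul_self h]

end ObliqueProjection

namespace DEIMSelection

variable {m n r : ℕ} (D : DEIMSelection m n r) {Cm Cn : ℝ}

/-- The oblique tangent projection as a linear map. -/
noncomputable def tangentProjLinear (Y : Matrix (Fin m) (Fin n) ℝ) :
    Matrix (Fin m) (Fin n) ℝ →ₗ[ℝ] Matrix (Fin m) (Fin n) ℝ where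
  toFun Z := D.tangentProj Y Z
  map_add' Z W := by
    simp only [tangentProj, Matrix.mul_add, Matrix.add_mul]; abel
  map_smul' c Z := by
    simp only [tangentProj, Matrix.mul_smul, Matrix.smul_mul, smul_add, smul_sub, RingHom.id_apply]

/-- Bounding the three terms separately would lose the product constant. The complement factors into
left and right complements, bounded by `Cm` and `Cn`; passing to its own complement keeps the bound
`Cm * Cn`. -/
theorem norm_tangentProj_le (hr : 0 < r) {Y : Matrix (Fin m) (Fin n) ℝ}
    (hY : Y ∈ rankManifold m n r) (hCm : spectralNorm₂ ((D.SU Y)ᵀ * D.U Y)⁻¹ ≤ Cm)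
    (hCn : spectralNorm₂ ((D.SV Y)ᵀ * D.V Y)⁻¹ ≤ Cn) (Z : Matrix (Fin m) (Fin n) ℝ) :
    ‖D.tangentProj Y Z‖ ≤ Cm * Cn * ‖Z‖ := by
  have hU := D.orthonormal_U Y hY
  have hV := D.orthonormal_V Y hY
  have hu := D.isUnit_rows Y hY
  have hv := D.isUnit_cols Y hY
  have h1m : 1 ≤ Cm := one_le_of_spectralNorm₂_le hr hU hu hCm
  have h1n : 1 ≤ Cn := one_le_of_spectralNorm₂_le hr hV hv hCn
  set P := obliqueLeft (D.U Y) (D.SU Y) with hP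
  set Q := obliqueRight (D.V Y) (D.SV Y) with hQ
  have hPP : P * P = P := obliqueLeft_mul_self hu
  have hQQ : Q * Q = Q := by
    rw [hQ, obliqueRight_eq_transpose, ← Matrix.transpose_mul]
    exact congrArg _ (obliqueLeft_mul_self hv)
  have hQn : ∀ W : Matrix (Fin m) (Fin n) ℝ, ‖W - W * Q‖ ≤ Cn * ‖W‖ := fun W ↦ by
    have := norm_sub_obliqueLeft_mul_le hr hV hv hCn Wᵀ
    rwa [Matrix.frobenius_norm_transpose, ← Matrix.frobenius_norm_transpose, Matrix.transpose_sub,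
      Matrix.transpose_mul, Matrix.transpose_transpose, ← obliqueRight_eq_transpose] at this
  have hcompl : ∀ W, W - D.tangentProj Y W = (W - P * W) - (W - P * W) * Q := fun W ↦ by
    simp only [tangentProj, Matrix.sub_mul]; abel
  have hPW : ∀ W : Matrix (Fin m) (Fin n) ℝ, P * (P * W) = P * W := fun W ↦ by
    rw [← Matrix.mul_assoc, hPP]
  have hWQ : ∀ W : Matrix (Fin m) (Fin n) ℝ, W * Q * Q = W * Q := fun W ↦ by
    rw [Matrix.mul_assoc, hQQ]
  have := Matrix.frobenius_norm_sub_apply_le (LinearMap.id - D.tangentProjLinear Y)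
    (fun W ↦ ?_) (one_le_mul_of_one_le_of_one_le h1m h1n) (fun W ↦ ?_) Z
  · simpa [tangentProjLinear] using this
  · change (W - D.tangentProj Y W) - D.tangentProj Y (W - D.tangentProj Y W) =
      W - D.tangentProj Y W
    rw [hcompl (W - D.tangentProj Y W), hcompl W]
    simp only [Matrix.sub_mul, Matrix.mul_sub, hPW, hWQ, ← Matrix.mul_assoc]
    abel
  · change ‖W - D.tangentProj Y W‖ ≤ _
    rw [hcompl]
    calc _ ≤ Cn * ‖W - P * W‖ := hQn _
      _ ≤ Cn * (Cm * ‖W‖) := by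
        gcongr
        exact norm_sub_obliqueLeft_mul_le hr hU hu hCm W
      _ = _ := by ring

end DEIMSelection

/-! ### Rank and singular values under perturbation. -/

theorem Matrix.isClosed_setOf_rank_le (m n r : ℕ) :
    IsClosed {X : Matrix (Fin m) (Fin n) ℝ | X.rank ≤ r} := by
  let φ : Matrix (Fin m) (Fin n) ℝ →ₗ[ℝ] ((Fin n → ℝ) →L[ℝ] (Fin m → ℝ)) :=
    LinearMap.toContinuousLinearMap.toLinearMap ∘ₗ Matrix.toLin'.toLinearMap
  have hφ : Continuous φ := φ.continuous_of_finiteDimensional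
  have hopen := (isOpen_setOfPred_nat_le_rank (𝕜 := ℝ) (E := Fin n → ℝ) (F := Fin m → ℝ)
    (n := r + 1)).preimage hφ
  rw [← isOpen_compl_iff]
  convert! hopen using 1
  ext X
  have : LinearMap.rank (φ X : (Fin n → ℝ) →ₗ[ℝ] (Fin m → ℝ)) = (X.rank : Cardinal) := by
    rw [Matrix.rank, Module.finrank_eq_rank]
    rfl
  simp only [mem_compl_iff, mem_ofPred_eq, mem_preimage, not_le]
  rw [this]
  norm_cast

section SingularValue

variable {m n r : ℕ}

/-- Orthonormal right singular vectors for the `r` largest singular values. -/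
theorem exists_orthonormal_sigma_mul_norm_le (hr : 0 < r) (hrn : r ≤ n)
    (X : Matrix (Fin m) (Fin n) ℝ) :
    ∃ J : Matrix (Fin n) (Fin r) ℝ, Jᵀ * J = 1 ∧
      ∀ (k : ℕ) (Z : Matrix (Fin r) (Fin k) ℝ), sigma r X * ‖Z‖ ≤ ‖X * J * Z‖ := by
  set T := Matrix.toEuclideanLin X with hT
  have hn : Module.finrank ℝ (EuclideanSpace ℝ (Fin n)) = n := by simp
  have hsym := T.isSymmetric_adjoint_comp_self
  let b := hsym.eigenvectorBasis hn
  let v : Fin r → EuclideanSpace ℝ (Fin n) := fun i ↦ b (Fin.castLE hrn i)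
  let lam : Fin r → ℝ := fun i ↦ hsym.eigenvalues hn (Fin.castLE hrn i)
  have hv : Orthonormal ℝ v := b.orthonormal.comp _ (Fin.castLE_injective hrn)
  have heig : ∀ i, T.adjoint (T (v i)) = lam i • v i := fun i ↦
    hsym.apply_eigenvectorBasis hn _
  have hlam : ∀ i, sigma r X ^ 2 ≤ lam i := fun i ↦ by
    have h1 : T.singularValues i ^ 2 = lam i := T.sq_singularValues_fin hn (Fin.castLE hrn i)
    rw [← h1]
    -- `sigma r` is the singular value of zero-based index `r - 1`, and every `i : Fin r` is at most
    -- `r - 1`.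
    exact pow_le_pow_left₀ (T.singularValues_nonneg _)
      (T.singularValues_antitone (by have := i.2; omega)) 2
  let J : Matrix (Fin n) (Fin r) ℝ := Matrix.of fun a i ↦ v i a
  have hin : ∀ i j, inner ℝ (T (v i)) (T (v j)) = if i = j then lam j else 0 := fun i j ↦ by
    rw [← LinearMap.adjoint_inner_right, heig, inner_smul_right,
      orthonormal_iff_ite.1 hv i j]
    simp
  have hXJ : ∀ a i, (X * J) a i = T (v i) a := fun a i ↦ by
    rw [hT, Matrix.ofLp_toLpLin]
    rfl
  have hdiag : (X * J)ᵀ * (X * J) = Matrix.diagonal lam := by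
    ext i j
    rw [Matrix.mul_apply, Matrix.diagonal_apply]
    have := hin i j
    rw [PiLp.inner_apply] at this
    simp only [Matrix.transpose_apply, hXJ]
    rw [show (if i = j then lam i else 0) = if i = j then lam j else 0 by grind, ← this]
    exact Finset.sum_congr rfl fun a _ ↦ by simp [mul_comm]
  refine ⟨J, ?_, fun k Z ↦ ?_⟩
  · ext i j
    have := orthonormal_iff_ite.1 hv i j
    rw [PiLp.inner_apply] at this
    rw [Matrix.mul_apply, Matrix.one_apply, ← this]
    exact Finset.sum_congr rfl fun a _ ↦ by simp [J, mul_comm]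
  · have hσ : 0 ≤ sigma r X := T.singularValues_nonneg _
    rw [← sq_le_sq₀ (by positivity) (norm_nonneg _), mul_pow,
      Matrix.frobenius_norm_sq_eq_trace (X * J * Z), Matrix.transpose_mul, Matrix.mul_assoc,
      ← Matrix.mul_assoc _ _ Z, hdiag, Matrix.frobenius_norm_sq, Finset.sum_comm, Finset.mul_sum,
      Matrix.trace]
    refine Finset.sum_le_sum fun j _ ↦ ?_
    rw [Matrix.diag_apply, Matrix.mul_apply, Finset.mul_sum]
    refine Finset.sum_le_sum fun i _ ↦ ?_
    rw [Matrix.diagonal_mul, Matrix.transpose_apply]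
    nlinarith [hlam i, sq_nonneg (Z i j)]

theorem sigma_pos (hr : 0 < r) {X : Matrix (Fin m) (Fin n) ℝ} (hX : X ∈ rankManifold m n r) :
    0 < sigma r X := by
  rw [sigma, LinearMap.singularValues_pos_iff_lt_finrank_range]
  have h : X.rank = Module.finrank ℝ (LinearMap.range (Matrix.toEuclideanLin X)) := by
    rw [Matrix.toEuclideanLin_eq_toLin_orthonormal]
    exact X.rank_eq_finrank_range_toLin _ _
  have hX' : X.rank = r := hX
  omega

/-- A substitute for Weyl's inequality: the singular frame `J` of the centre serves the whole ball.
-/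
theorem mul_norm_le_of_norm_sub_le {X₀ X : Matrix (Fin m) (Fin n) ℝ} {J : Matrix (Fin n) (Fin r) ℝ}
    {σ ρ : ℝ} (hJ : Jᵀ * J = 1)
    (hσ : ∀ (k : ℕ) (Z : Matrix (Fin r) (Fin k) ℝ), σ * ‖Z‖ ≤ ‖X₀ * J * Z‖)
    (hX : ‖X - X₀‖ ≤ ρ) (k : ℕ) (Z : Matrix (Fin r) (Fin k) ℝ) :
    (σ - ρ) * ‖Z‖ ≤ ‖X * J * Z‖ := by
  have h1 : X₀ * J * Z = X * J * Z - (X - X₀) * (J * Z) := by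
    simp only [Matrix.sub_mul, Matrix.mul_assoc]; abel
  have h2 : ‖(X - X₀) * (J * Z)‖ ≤ ρ * ‖Z‖ := by
    refine (Matrix.frobenius_norm_mul _ _).trans ?_
    rw [Matrix.frobenius_norm_mul_of_orthonormal hJ]
    gcongr
  have h3 := hσ k Z
  rw [h1] at h3
  linarith [norm_sub_le (X * J * Z) ((X - X₀) * (J * Z))]

theorem Matrix.mulVec_injective_of_mul_norm_le {A : Matrix (Fin m) (Fin r) ℝ} {c : ℝ} (hc : 0 < c)
    (hA : ∀ (k : ℕ) (Z : Matrix (Fin r) (Fin k) ℝ), c * ‖Z‖ ≤ ‖A * Z‖) :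
    Function.Injective A.mulVecLin := by
  rw [← LinearMap.ker_eq_bot, LinearMap.ker_eq_bot']
  intro x hx
  have h1 := hA 1 (Matrix.replicateCol (Fin 1) x)
  rw [← Matrix.replicateCol_mulVec, show A *ᵥ x = 0 from hx, Matrix.replicateCol_zero,
    norm_zero] at h1
  have h2 : Matrix.replicateCol (Fin 1) x = 0 := by
    rw [← norm_le_zero_iff]
    by_contra! h
    nlinarith
  ext i
  exact congrFun (congrFun h2 i) 0

theorem le_rank_of_mul_norm_le {X : Matrix (Fin m) (Fin n) ℝ} {J : Matrix (Fin n) (Fin r) ℝ}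
    {c : ℝ} (hc : 0 < c)
    (hX : ∀ (k : ℕ) (Z : Matrix (Fin r) (Fin k) ℝ), c * ‖Z‖ ≤ ‖X * J * Z‖) : r ≤ X.rank := by
  refine le_trans (le_of_eq ?_) (Matrix.rank_mul_le_left X J)
  rw [Matrix.rank, LinearMap.finrank_range_of_inj (Matrix.mulVec_injective_of_mul_norm_le hc hX)]
  simp

/-- The core factor of a matrix which is bounded below on an `r`-dimensional space is invertible
with bounded inverse. -/
theorem isUnit_det_core_and_norm_inv_mul_le {X : Matrix (Fin m) (Fin n) ℝ}
    {J : Matrix (Fin n) (Fin r) ℝ} {c : ℝ} (hc : 0 < c) (hJ : Jᵀ * J = 1)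
    (hX : ∀ (k : ℕ) (Z : Matrix (Fin r) (Fin k) ℝ), c * ‖Z‖ ≤ ‖X * J * Z‖)
    {U : Matrix (Fin m) (Fin r) ℝ} {V : Matrix (Fin n) (Fin r) ℝ} {C : Matrix (Fin r) (Fin r) ℝ}
    (hU : Uᵀ * U = 1) (hV : Vᵀ * V = 1) (h : X = U * C * Vᵀ) :
    IsUnit C.det ∧ ∀ (k : ℕ) (Z : Matrix (Fin r) (Fin k) ℝ), ‖C⁻¹ * Z‖ ≤ c⁻¹ * ‖Z‖ := by
  set W := Vᵀ * J with hW
  -- Since `U` is isometric, the lower bound passes to `C * W`, making both factors invertible; `W`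
  -- is a contraction, so the bound survives for `C` alone.
  have h1 : ∀ (k : ℕ) (Z : Matrix (Fin r) (Fin k) ℝ), c * ‖Z‖ ≤ ‖C * W * Z‖ := fun k Z ↦ by
    have := hX k Z
    rwa [h, show U * C * Vᵀ * J * Z = U * (C * W * Z) by simp only [hW, Matrix.mul_assoc],
      Matrix.frobenius_norm_mul_of_orthonormal hU] at this
  have h2 : IsUnit (C * W) := by
    rw [← Matrix.mulVec_injective_iff_isUnit]
    exact Matrix.mulVec_injective_of_mul_norm_le hc h1
  rw [Matrix.isUnit_iff_isUnit_det, Matrix.det_mul, IsUnit.mul_iff] at h2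
  refine ⟨h2.1, fun k Z ↦ ?_⟩
  have hWn : ∀ Z : Matrix (Fin r) (Fin k) ℝ, ‖W * Z‖ ≤ ‖Z‖ := fun Z ↦ by
    rw [hW, Matrix.mul_assoc]
    refine (Matrix.frobenius_norm_transpose_mul_le_of_orthonormal hV _).trans ?_
    rw [Matrix.frobenius_norm_mul_of_orthonormal hJ]
  have h3 := hWn (W⁻¹ * (C⁻¹ * Z))
  have h4 := h1 k (W⁻¹ * (C⁻¹ * Z))
  rw [Matrix.mul_assoc C W, Matrix.mul_nonsing_inv_cancel_left _ _ h2.2,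
    Matrix.mul_nonsing_inv_cancel_left _ _ h2.1] at h4
  rw [Matrix.mul_nonsing_inv_cancel_left _ _ h2.2] at h3
  rw [inv_mul_eq_div, le_div_iff₀ hc]
  nlinarith

end SingularValue

/-! ### The second-order retraction. -/

namespace DEIMSelection

variable {m n r : ℕ} (D : DEIMSelection m n r) {Cm Cn : ℝ}

/-- A second order retraction: Euler steps along the tangent projection can be corrected to
matrices of rank at most `r` at the cost of a quadratic error. -/
theorem exists_rank_le_norm_sub_euler_le (hr : 0 < r) {Y Z : Matrix (Fin m) (Fin n) ℝ}
    {J : Matrix (Fin n) (Fin r) ℝ} {c B : ℝ} (hY : Y ∈ rankManifold m n r)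
    (hCm : spectralNorm₂ ((D.SU Y)ᵀ * D.U Y)⁻¹ ≤ Cm)
    (hCn : spectralNorm₂ ((D.SV Y)ᵀ * D.V Y)⁻¹ ≤ Cn) (hc : 0 < c) (hJ : Jᵀ * J = 1)
    (hYJ : ∀ (k : ℕ) (W : Matrix (Fin r) (Fin k) ℝ), c * ‖W‖ ≤ ‖Y * J * W‖) (hZ : ‖Z‖ ≤ B)
    (h : ℝ) :
    ∃ Y' : Matrix (Fin m) (Fin n) ℝ, Y'.rank ≤ r ∧
      ‖Y' - (Y + h • D.tangentProj Y Z)‖ ≤ (Cn * (Cm * B) * (c⁻¹ * (Cm * B))) * h ^ 2 := by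
  have hU := D.orthonormal_U Y hY
  have hV := D.orthonormal_V Y hY
  have hu := D.isUnit_rows Y hY
  have hv := D.isUnit_cols Y hY
  have hm0 : 0 ≤ Cm := (norm_nonneg _).trans hCm
  have hn0 : 0 ≤ Cn := (norm_nonneg _).trans hCn
  obtain ⟨C, hfac⟩ := D.factorization Y hY
  obtain ⟨hC, hCinv⟩ := isUnit_det_core_and_norm_inv_mul_le hc hJ hYJ hU hV hfac
  set U := D.U Y
  set V := D.V Y
  set G := ((D.SU Y)ᵀ * U)⁻¹ * (D.SU Y)ᵀ with hG
  set H := ((D.SV Y)ᵀ * V)⁻¹ * (D.SV Y)ᵀ with hH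
  have hP : obliqueLeft U (D.SU Y) = U * G := Matrix.mul_assoc _ _ _
  have hQ : obliqueRight V (D.SV Y) = Hᵀ * Vᵀ := by
    rw [obliqueRight_eq_transpose, ← Matrix.transpose_mul, hH, obliqueLeft, Matrix.mul_assoc]
  set A := G * Z with hA
  set E := (Z - U * G * Z) * Hᵀ with hE
  have hf : D.tangentProj Y Z = U * A + E * Vᵀ := by
    rw [tangentProj, hP, hQ, hA, hE]
    simp only [Matrix.sub_mul, Matrix.mul_assoc]
    abel
  have hAn : ‖A‖ ≤ Cm * B := (norm_core_mul_le hu hCm Z).trans (by gcongr)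
  have hEn : ‖E‖ ≤ Cn * (Cm * B) := by
    rw [← Matrix.frobenius_norm_transpose, hE, Matrix.transpose_mul, Matrix.transpose_transpose]
    refine (norm_core_mul_le hv hCn _).trans ?_
    gcongr
    rw [Matrix.frobenius_norm_transpose, ← hP]
    exact (norm_sub_obliqueLeft_mul_le hr hU hu hCm Z).trans (by gcongr)
  -- The inner dimension `r` bounds the rank. Expanding gives `U C Vᵀ + h (U A + E Vᵀ) + h² E C⁻¹
  -- A`, whose first-order part is the Euler step.
  refine ⟨(U + h • (E * C⁻¹)) * (C * Vᵀ + h • A), ?_, ?_⟩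
  · exact (Matrix.rank_mul_le_left _ _).trans ((Matrix.rank_le_card_width _).trans (by simp))
  · have key : (U + h • (E * C⁻¹)) * (C * Vᵀ + h • A) - (Y + h • D.tangentProj Y Z) =
        h ^ 2 • (E * (C⁻¹ * A)) := by
      have h1 : E * (C⁻¹ * (C * Vᵀ)) = E * Vᵀ := by
        rw [Matrix.nonsing_inv_mul_cancel_left _ _ hC]
      rw [hf, hfac]
      simp only [Matrix.add_mul, Matrix.mul_add, Matrix.smul_mul, Matrix.mul_smul, smul_add,
        Matrix.mul_assoc, h1, smul_smul, sq]
      abel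
    rw [key, norm_smul, Real.norm_of_nonneg (sq_nonneg h), mul_comm]
    gcongr
    refine (Matrix.frobenius_norm_mul _ _).trans ?_
    have := hCinv _ A
    have hB : 0 ≤ B := (norm_nonneg _).trans hZ
    gcongr
    exact this.trans (by gcongr)

end DEIMSelection

/-! ### Existence up to the exit time. -/

theorem mainTheorem1 (m n r : ℕ) (hr : 0 < r) (D : DEIMSelection m n r)
    (Cm Cn : ℝ)
    (hCm : ∀ Y ∈ rankManifold m n r, spectralNorm₂ ((D.SU Y)ᵀ * D.U Y)⁻¹ ≤ Cm)
    (hCn : ∀ Y ∈ rankManifold m n r, spectralNorm₂ ((D.SV Y)ᵀ * D.V Y)⁻¹ ≤ Cn)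
    (F : Matrix (Fin m) (Fin n) ℝ → Matrix (Fin m) (Fin n) ℝ)
    (B : ℝ) (hB : 0 < B) (hF : ∀ X, ‖F X‖ ≤ B)
    (Y₀ : Matrix (Fin m) (Fin n) ℝ) (hY₀ : Y₀ ∈ rankManifold m n r) :
    ∃ tmax : ℝ, sigma r Y₀ / (2 * Cm * Cn * B) < tmax ∧
      ∃ Y : ℝ → Matrix (Fin m) (Fin n) ℝ,
        ∀ T : ℝ, 0 ≤ T → T < tmax → D.IsSolutionOn F Y₀ Y T := by
  have h1m : 1 ≤ Cm := one_le_of_spectralNorm₂_le hr (D.orthonormal_U _ hY₀)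
    (D.isUnit_rows _ hY₀) (hCm _ hY₀)
  have h1n : 1 ≤ Cn := one_le_of_spectralNorm₂_le hr (D.orthonormal_V _ hY₀)
    (D.isUnit_cols _ hY₀) (hCn _ hY₀)
  have hσ := sigma_pos hr hY₀
  have hrn : r ≤ n := by
    have h1 : Y₀.rank = r := hY₀
    exact h1 ▸ (Matrix.rank_le_card_width Y₀).trans (by simp)
  obtain ⟨J, hJ, hJσ⟩ := exists_orthonormal_sigma_mul_norm_le hr hrn Y₀
  set σ := sigma r Y₀ with hσdef
  have hL : 0 < Cm * Cn * B := by positivity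
  -- Any fraction strictly between `1/2` and `1` would do: above `1/2` for the strict time bound,
  -- below `1` to keep the rank from dropping.
  let ρ : ℝ := 3 / 4 * σ
  have hρ : ρ < σ := by simp only [ρ]; linarith
  let S := Metric.closedBall Y₀ ρ ∩ rankManifold m n r
  have hlow : ∀ X ∈ Metric.closedBall Y₀ ρ, ∀ (k : ℕ) (Z : Matrix (Fin r) (Fin k) ℝ),
      (σ - ρ) * ‖Z‖ ≤ ‖X * J * Z‖ := fun X hX ↦
    mul_norm_le_of_norm_sub_le hJ hJσ (mem_closedBall_iff_norm.1 hX)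
  have hmem : ∀ X ∈ Metric.closedBall Y₀ ρ, X.rank ≤ r → X ∈ rankManifold m n r := fun X hX h ↦
    h.antisymm (le_rank_of_mul_norm_le (sub_pos.2 hρ) (hlow X hX))
  have hSeq : S = Metric.closedBall Y₀ ρ ∩ {X | X.rank ≤ r} := by
    ext X
    exact ⟨fun h ↦ ⟨h.1, le_of_eq h.2⟩, fun h ↦ ⟨h.1, hmem X h.1 h.2⟩⟩
  have hS : IsClosed S := hSeq ▸ Metric.isClosed_closedBall.inter
    (Matrix.isClosed_setOf_rank_le m n r)
  obtain ⟨Y, hLip, hY0, hYS, hYd⟩ := exists_lipschitz_filippov_solution (S := S) (f := D.field F)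
    (y₀ := Y₀) (ρ := ρ) (L := Cm * Cn * B)
    (K := Cn * (Cm * B) * ((σ - ρ)⁻¹ * (Cm * B))) hL.le
    (by have := sub_pos.2 hρ; positivity) hS inter_subset_left
    ⟨Metric.mem_closedBall_self (by positivity), hY₀⟩
    (fun X hX ↦ (D.norm_tangentProj_le hr hX.2 (hCm X hX.2) (hCn X hX.2) (F X)).trans
      (by gcongr; exact hF X))
    (fun X hX h _ ↦ by
      obtain ⟨Y', h1, h2⟩ := D.exists_rank_le_norm_sub_euler_le hr hX.2 (hCm X hX.2) (hCn X hX.2)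
        (sub_pos.2 hρ) hJ (hlow X hX.1) (hF X) h
      exact ⟨Y', h2, fun hb ↦ ⟨hb, hmem Y' hb h1⟩⟩)
  refine ⟨ρ / (Cm * Cn * B), ?_, Y, fun T hT0 hT ↦ ⟨?_, fun t _ ↦ (hYS t).2, hY0, ?_⟩⟩
  · rw [show 2 * Cm * Cn * B = 2 * (Cm * Cn * B) by ring, div_lt_div_iff₀ (by positivity) hL]
    simp only [ρ]
    nlinarith [mul_pos hσ hL]
  · exact hLip.lipschitzOnWith.absolutelyContinuousOnInterval
  · rw [lt_div_iff₀ hL] at hT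
    -- Rademacher's theorem on the line supplies the derivative almost everywhere.
    filter_upwards [ae_restrict_of_ae hLip.ae_differentiableAt_real,
      ae_restrict_mem measurableSet_Icc] with t hdiff ht
    refine ⟨deriv Y t, ?_, hdiff.hasDerivAt⟩
    simp only [DEIMSelection.filippov, mem_iInter]
    intro ε hε
    have hsub : Metric.closedBall (Y t) ε ∩ S ⊆ Metric.closedBall (Y t) ε ∩ rankManifold m n r :=
      inter_subset_inter_right _ inter_subset_right
    refine closure_mono (convexHull_mono (image_mono hsub)) ?_
    exact hYd t ht.1 (by nlinarith [ht.2]) _ hdiff.hasDerivAt ε hε
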